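/- Let $\mathcal H=\ell^2(\mathbb N,\mathbb C)$ be the Hilbert space of a single mode, with Fock basis $\{|n\rangle\}_{n\in\mathbb N}$. A pure state is a unit vector $|\psi\rangle=\sum_{n\ge 0}\psi_n|n\rangle\in\mathcal H$ (up to a global phase). Its stellar function is the entire function $F^\star_\psi(\alpha)=\sum_{n\ge0}\psi_n\frac{\alpha^n}{\sqrt{n!}}$, $\alpha\in\mathbb C$, and its stellar rank $r^\star(\psi)\in\mathbb N\cup\{+\infty\}$ is the number of zeros of $F^\star_\psi$ in $\mathbb C$, counted with multiplicity. Let $R_N$ be the set of pure states of stellar rank exactly $N$. The set of pure states carries the topology of the trace norm distance $\big\||\phi\rangle\langle\phi|-|\psi\rangle\langle\psi|\big\|_1$, where $\|T\|_1=\operatorname{Tr}\sqrt{T^\dagger T}$, and closures are taken in the set of pure states. The trace distance is $D_1(\phi,\psi)=\frac12\big\||\phi\rangle\langle\phi|-|\psi\rangle\langle\psi|\big\|_1$, and the stellar robustness of $\psi$ is $R^\star(\psi)=\inf\{D_1(\phi,\psi):\ \phi \text{ a pure state},\ r^\star(\phi)<r^\star(\psi)\}$, with $\inf\varnothing=+\infty$.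 For every $N\in\mathbb N$, $$\overline{R_N}=\bigcup_{0\le K\le N}R_K .$$ Consequently, for every $N\in\mathbb N$ the set of pure states of stellar rank at most $N$ is closed, and every pure state $\psi$ of finite stellar rank satisfies $R^\star(\psi)>0$. -/

import Mathlib

open scoped ENNReal

noncomputable section

namespace Stellar

/-- The Hilbert space of a single mode, `ℓ²(ℕ, ℂ)`: a vector is the square-summable sequence
`ψ 0, ψ 1, …` of its coordinates in the Fock basis. -/
abbrev ModeSpace : Type := lp (fun _ : ℕ => ℂ) 2

/-- The Fock basis `|0⟩, |1⟩, …`: the standard orthonormal basis of `ℓ²(ℕ, ℂ)`. -/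
def fockBasis : HilbertBasis ℕ ℂ ModeSpace :=
  HilbertBasis.ofRepr (LinearIsometryEquiv.refl ℂ ModeSpace)

/-- A normalised pure single-mode state, represented by a unit vector. (Vectors that differ by a
global phase are at trace distance zero, and have the same stellar rank.) -/
structure PureState where
  /-- the unit vector `|ψ⟩` -/
  vec : ModeSpace
  norm_vec : ‖vec‖ = 1

/-- The density operator `|ψ⟩⟨ψ|` of a pure state. -/
def PureState.density (ψ : PureState) : ModeSpace →L[ℂ] ModeSpace :=
  InnerProductSpace.rankOne ℂ ψ.vec ψ.vec

/-- The trace norm `‖T‖₁ = Tr |T|` of a bounded operator on a Hilbert space with countable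
orthonormal basis `b`, where `|T| = √(T† T)` and the trace of the positive operator `|T|` is the sum
of its (nonnegative) diagonal entries; the value does not depend on `b`, and it is `∞` exactly when
`T` is not trace class. -/
def traceNormOf {H : Type} [NormedAddCommGroup H] [InnerProductSpace ℂ H] [CompleteSpace H]
    (b : HilbertBasis ℕ ℂ H) (T : H →L[ℂ] H) : ℝ≥0∞ :=
  ∑' n : ℕ, ENNReal.ofReal (RCLike.re (inner ℂ (b n) (CFC.abs T (b n))))

/-- The trace norm of an operator on the single-mode Hilbert space. -/
def traceNorm (T : ModeSpace →L[ℂ] ModeSpace) : ℝ≥0∞ := traceNormOf fockBasis T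

/-- The trace distance `D₁(φ, ψ) = ½ ‖ |φ⟩⟨φ| - |ψ⟩⟨ψ| ‖₁` of two pure states. -/
def traceDist (φ ψ : PureState) : ℝ≥0∞ :=
  traceNorm (φ.density - ψ.density) / 2

/-- The trace-norm topology on the set of pure states: a set is open if and only if it contains,
with each of its points, a ball of positive radius in the trace norm. -/
instance : TopologicalSpace PureState where
  IsOpen U := ∀ ψ ∈ U, ∃ ε : ℝ≥0∞, 0 < ε ∧
    ∀ φ : PureState, traceNorm (φ.density - ψ.density) < ε → φ ∈ U
  isOpen_univ := fun _ _ => ⟨1, one_pos, fun _ _ => trivial⟩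
  isOpen_inter := by
    intro U V hU hV ψ hψ
    obtain ⟨ε, hε, h⟩ := hU ψ hψ.1
    obtain ⟨δ, hδ, h'⟩ := hV ψ hψ.2
    exact ⟨min ε δ, lt_min hε hδ, fun φ hφ =>
      ⟨h φ (hφ.trans_le (min_le_left _ _)), h' φ (hφ.trans_le (min_le_right _ _))⟩⟩
  isOpen_sUnion := by
    intro S hS ψ hψ
    obtain ⟨U, hU, hψU⟩ := hψ
    obtain ⟨ε, hε, h⟩ := hS U hU ψ hψU
    exact ⟨ε, hε, fun φ hφ => ⟨U, hU, h φ hφ⟩⟩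

/-- The stellar function `F_ψ(α) = ∑ₙ ψₙ αⁿ / √(n!)`. -/
def stellarFunction (ψ : PureState) (α : ℂ) : ℂ :=
  ∑' n : ℕ, ψ.vec n * α ^ n / ((Real.sqrt (n.factorial : ℝ) : ℝ) : ℂ)

/-- The stellar rank: the number, in `ℕ ∪ {∞}`, of zeros of the stellar function counted with
multiplicity, that is, the sum over all `α ∈ ℂ` of the vanishing order of the stellar function at
`α` (a sum of elements of `ℕ ∪ {∞}` is the supremum of its finite partial sums). -/
def stellarRank (ψ : PureState) : ℕ∞ :=
  ⨆ s : Finset ℂ, ∑ α ∈ s, analyticOrderAt (stellarFunction ψ) α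

/-- The set `R_N` of pure states of stellar rank exactly `N`. -/
def rankSet (N : ℕ∞) : Set PureState := {ψ | stellarRank ψ = N}

/-- The stellar robustness of `ψ`: the infimum of the trace distances from `ψ` to the pure states
of strictly smaller stellar rank. (The infimum of the empty set is `∞`.) -/
def stellarRobustness (ψ : PureState) : ℝ≥0∞ :=
  ⨅ (φ : PureState) (_ : stellarRank φ < stellarRank ψ), traceDist φ ψ

end Stellar

end

/-!
The stellar function of a vector `v` is its inner product with the coherent vectors
(`bargmann_eq_inner`), so vectors that are close in norm have stellar functions that are uniformly
close on every disc. Two facts carry the theorem.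

* The stellar rank is lower semicontinuous. For entire functions this is Hurwitz's theorem in the
  form `le_zeroCount_of_near`: if `f` is entire, not identically zero, with at least `n` zeros, then
  every entire `g` uniformly close to `f` on a suitable disc has at least `n` zeros. Trace distance controls
  vectors only up to a scalar, but scalars do not move zeros: `traceNorm_density_sub` evaluates the
  trace norm of `|φ⟩⟨φ| - |ψ⟩⟨ψ|` as `2 √(1 - |⟨φ, ψ⟩|²) = 2 ‖ψ - ⟨φ, ψ⟩ φ‖`. Thus the states of
  rank at least `n` form an open set, which gives the closedness statement, the inclusion of the
  closure of `R_N` in the union, and the positivity of the robustness.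
* A state of rank `K` is a limit of states of rank `K + 1` (`exists_near_stellarRank_eq`). If `F` is
  the stellar function, then `(1 - (1 - r) α) F(r α)` with `r < 1` has exactly one more zero; its
  Fock coordinates are square-summable because of the dilation, and they converge to those of the
  state as `r → 1`, by dominated convergence. No factorisation theorem for entire functions of
  finite order is needed.
-/

/-! ### Zeros of entire functions -/

namespace Stellar

open Metric Filter Topology

/-- The number, in `ℕ ∪ {∞}`, of zeros of a function `ℂ → ℂ`, counted with multiplicity. -/
noncomputable def zeroCount (f : ℂ → ℂ) : ℕ∞ :=
  ⨆ s : Finset ℂ, ∑ α ∈ s, analyticOrderAt f α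

theorem zeroCount_mul {f g : ℂ → ℂ} (hf : Differentiable ℂ f) (hg : Differentiable ℂ g) :
    zeroCount (f * g) = zeroCount f + zeroCount g := by
  have mono (h : ℂ → ℂ) : Monotone fun s : Finset ℂ => ∑ α ∈ s, analyticOrderAt h α :=
    fun s t hst => Finset.sum_le_sum_of_subset hst
  unfold zeroCount
  rw [ENat.iSup_add_iSup_of_monotone (mono f) (mono g)]
  refine iSup_congr fun s => ?_
  rw [← Finset.sum_add_distrib]
  exact Finset.sum_congr rfl fun α _ => analyticOrderAt_mul (hf.analyticAt α) (hg.analyticAt α)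

theorem zeroCount_eq_zero_of_forall_ne {f : ℂ → ℂ} (h : ∀ z, f z ≠ 0) : zeroCount f = 0 := by
  unfold zeroCount
  simp [analyticOrderAt_eq_zero.2 (Or.inr (h _))]

theorem zeroCount_const_mul {f : ℂ → ℂ} (hf : Differentiable ℂ f) {c : ℂ} (hc : c ≠ 0) :
    zeroCount (fun z => c * f z) = zeroCount f := by
  have h := zeroCount_mul (f := fun _ => c) (differentiable_const c) hf
  rw [zeroCount_eq_zero_of_forall_ne fun _ => hc, zero_add] at h
  exact h

theorem zeroCount_sub_const (c : ℂ) : zeroCount (fun z => z - c) = 1 := by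
  unfold zeroCount
  refine le_antisymm (iSup_le fun s => ?_) (le_iSup_of_le {c} (by simp))
  by_cases hc : c ∈ s
  · rw [Finset.sum_eq_single_of_mem c hc fun b _ hb => analyticOrderAt_id_sub_const_of_ne hb]
    simp
  · rw [Finset.sum_eq_zero fun b hb =>
      analyticOrderAt_id_sub_const_of_ne fun h : b = c => hc (h ▸ hb)]
    simp

theorem zeroCount_sub_mul {f : ℂ → ℂ} (hf : Differentiable ℂ f) (c : ℂ) :
    zeroCount (fun z => (z - c) * f z) = 1 + zeroCount f := by
  rw [← zeroCount_sub_const c]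
  exact zeroCount_mul (differentiable_id.sub_const c) hf

theorem zeroCount_comp_mul (f : ℂ → ℂ) {c : ℂ} (hc : c ≠ 0) :
    zeroCount (fun z => f (c * z)) = zeroCount f := by
  have hord (z : ℂ) : analyticOrderAt (fun z => f (c * z)) z = analyticOrderAt f (c * z) := by
    have hg : HasDerivAt (fun z => c * z) c z := by simpa using (hasDerivAt_id z).const_mul c
    exact analyticOrderAt_comp_of_deriv_ne_zero (f := f) (g := fun z => c * z)
      (by fun_prop) (by rwa [hg.deriv])
  unfold zeroCount
  simp only [hord]
  let e : ℂ ≃ ℂ := Equiv.mulLeft₀ c hc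
  refine Equiv.iSup_congr (Equiv.finsetCongr e) fun s => ?_
  simp [e, Finset.sum_map]

theorem exists_zero_of_zeroCount_ne_zero {f : ℂ → ℂ} (h : zeroCount f ≠ 0) : ∃ a, f a = 0 := by
  by_contra! h'
  exact h (zeroCount_eq_zero_of_forall_ne h')

/-- An entire function splits off the linear factor of each of its zeros. -/
theorem exists_eq_sub_mul {f : ℂ → ℂ} (hf : Differentiable ℂ f) {a : ℂ} (ha : f a = 0) :
    ∃ g : ℂ → ℂ, Differentiable ℂ g ∧ f = fun z => (z - a) * g z := by
  refine ⟨dslope f a, ?_, ?_⟩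
  · rw [← differentiableOn_univ] at hf ⊢
    exact (Complex.differentiableOn_dslope univ_mem).2 hf
  · ext z
    simpa using (sub_smul_dslope_of_zero ha z).symm

/-- Zeros persist under perturbation: an entire function uniformly close, on a suitable disc, to an
entire function that vanishes at `a` without vanishing identically has a zero near `a`. -/
theorem exists_zero_near {f : ℂ → ℂ} (hf : Differentiable ℂ f) (hf0 : ∃ z, f z ≠ 0) {a : ℂ}
    (ha : f a = 0) {δ : ℝ} (hδ : 0 < δ) :
    ∃ ε > 0, ∀ g : ℂ → ℂ, Differentiable ℂ g → (∀ z ∈ closedBall a δ, ‖g z - f z‖ ≤ ε) →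
      ∃ b ∈ closedBall a δ, g b = 0 := by
  -- The zero `a` is isolated, so `f` is bounded below on a small circle around it.
  have hiso : ∀ᶠ z in 𝓝[≠] a, f z ≠ 0 := by
    refine (hf.analyticAt a).eventually_eq_zero_or_eventually_ne_zero.resolve_left fun h => ?_
    obtain ⟨z, hz⟩ := hf0
    have := (AnalyticOnNhd.analyticOrderAt_eq_top_iff_eq_zero a fun w => hf.analyticAt w).1
      (analyticOrderAt_eq_top.2 h)
    exact hz (by simp [this])
  rw [eventually_nhdsWithin_iff, Metric.eventually_nhds_iff_ball] at hiso
  obtain ⟨η, hη, hne⟩ := hiso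
  obtain ⟨r, hr, hrη⟩ := exists_between (lt_min hη hδ)
  obtain ⟨hrη, hrδ⟩ := lt_min_iff.1 hrη
  have hsub : closedBall a r ⊆ closedBall a δ := closedBall_subset_closedBall hrδ.le
  obtain ⟨w, hw, hmin⟩ := (isCompact_sphere a r).exists_isMinOn
    (NormedSpace.sphere_nonempty.2 hr.le) hf.continuous.norm.continuousOn
  have hm : 0 < ‖f w‖ := norm_pos_iff.2 <| hne w (mem_ball.2 ((mem_sphere.1 hw).trans_lt hrη))
    fun h => hr.ne' (by rw [← mem_sphere.1 hw, Set.mem_singleton_iff.1 h, dist_self])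
  refine ⟨‖f w‖ / 5, by positivity, fun g hg hgf => ?_⟩
  have hga : ‖g a‖ ≤ ‖f w‖ / 5 := by
    simpa [ha] using hgf a (mem_closedBall_self hδ.le)
  -- With `ε = ‖f w‖ / 5`, the function `g - g a` is bounded below by `3 ε` on the circle, so that
  -- `g` takes on the disc all values in the ball of radius `3 ε / 2` around `g a`; `0` is among them.
  have hlow : ∀ z ∈ sphere a r, ‖f w‖ * (3 / 5) ≤ ‖g z - g a‖ := fun z hz => by
    have h1 : ‖f w‖ ≤ ‖f z‖ := hmin hz
    have h2 := hgf z (hsub (sphere_subset_closedBall hz))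
    have h3 : ‖f z‖ ≤ ‖g z - g a‖ + ‖g z - f z‖ + ‖g a‖ := by
      have : f z = (g z - g a) - (g z - f z) + g a := by ring
      calc ‖f z‖ = ‖(g z - g a) - (g z - f z) + g a‖ := by rw [← this]
        _ ≤ _ := (norm_add_le _ _).trans (by gcongr; exact norm_sub_le _ _)
    linarith
  have hfreq : ∃ᶠ z in 𝓝 a, g z ≠ g a := by
    intro h
    have h0 : (fun z => g z - g a) = 0 :=
      (AnalyticOnNhd.analyticOrderAt_eq_top_iff_eq_zero a fun z =>
        (hg.analyticAt z).sub analyticAt_const).1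
        (analyticOrderAt_eq_top.2 (h.mono fun z hz => sub_eq_zero.2 (not_not.1 hz)))
    have h1 := hlow w hw
    rw [show g w - g a = 0 from congrFun h0 w, norm_zero] at h1
    linarith
  obtain ⟨b, hb, hb0⟩ := hg.diffContOnCl.ball_subset_image_closedBall hr hlow hfreq
    (show (0 : ℂ) ∈ ball (g a) (‖f w‖ * (3 / 5) / 2) by
      rw [mem_ball, dist_zero_left]; linarith)
  exact ⟨b, hsub hb, hb0⟩

/-- Lower semicontinuity of the number of zeros (a form of Hurwitz's theorem). The induction divides
out one zero of `f` and a nearby zero of `g`; by the maximum principle the quotients are close on a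
disc as soon as they are close on its boundary circle, which stays away from both zeros. -/
theorem le_zeroCount_of_near (n : ℕ) : ∀ {f : ℂ → ℂ}, Differentiable ℂ f → (∃ z, f z ≠ 0) →
    (n : ℕ∞) ≤ zeroCount f → ∃ R > 0, ∃ ε > 0, ∀ g : ℂ → ℂ, Differentiable ℂ g →
      (∀ z ∈ closedBall (0 : ℂ) R, ‖g z - f z‖ ≤ ε) → (n : ℕ∞) ≤ zeroCount g := by
  induction n with
  | zero => exact fun _ _ _ => ⟨1, one_pos, 1, one_pos, by simp⟩
  | succ n ih =>
    intro f hf hf0 hn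
    obtain ⟨a, ha⟩ := exists_zero_of_zeroCount_ne_zero (f := f) <| by
      rintro h
      rw [h] at hn
      simp at hn
    obtain ⟨f₁, hf₁, hff₁⟩ := exists_eq_sub_mul hf ha
    have hcancel {x : ℕ∞} (h : ((n + 1 : ℕ) : ℕ∞) ≤ 1 + x) : (n : ℕ∞) ≤ x := by
      rw [Nat.cast_add, Nat.cast_one, add_comm] at h
      exact (ENat.add_le_add_iff_left (by simp)).1 h
    obtain ⟨R₁, hR₁, ε₁, hε₁, h₁⟩ := ih hf₁
      (by obtain ⟨z, hz⟩ := hf0; exact ⟨z, fun h => hz (by simp [hff₁, h])⟩)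
      (hcancel (by rwa [← zeroCount_sub_mul hf₁ a, ← hff₁]))
    set R := max R₁ (‖a‖ + 2) with hR
    have hR0 : 0 < R := hR₁.trans_le (le_max_left _ _)
    obtain ⟨M, hM⟩ := (isCompact_closedBall (0 : ℂ) R).exists_bound_of_continuousOn
      hf₁.continuous.continuousOn
    have hM0 : 0 ≤ M := (norm_nonneg _).trans (hM 0 (mem_closedBall_self hR0.le))
    set δ := min 1 (ε₁ / (2 * (M + 1)))
    have hδ : 0 < δ := by positivity
    have hδ1 : δ ≤ 1 := min_le_left _ _
    have hδM : M * δ ≤ ε₁ / 2 := by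
      have h : δ ≤ ε₁ / (2 * (M + 1)) := min_le_right _ _
      rw [le_div_iff₀ (by positivity)] at h
      nlinarith
    obtain ⟨ε₂, hε₂, h₂⟩ := exists_zero_near hf hf0 ha hδ
    refine ⟨R, hR0, min ε₂ (ε₁ / 2), by positivity, fun g hg hgf => ?_⟩
    have hsub : closedBall a δ ⊆ closedBall 0 R := fun z hz => by
      rw [mem_closedBall, dist_eq_norm] at hz
      have := norm_sub_norm_le z a
      have := le_max_right R₁ (‖a‖ + 2)
      rw [mem_closedBall_zero_iff]
      linarith
    obtain ⟨b, hb, hgb⟩ := h₂ g hg fun z hz => (hgf z (hsub hz)).trans (min_le_left _ _)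
    obtain ⟨g₁, hg₁, hgg₁⟩ := exists_eq_sub_mul hg hgb
    rw [mem_closedBall, dist_eq_norm] at hb
    have hsphere : ∀ z ∈ sphere (0 : ℂ) R, ‖g₁ z - f₁ z‖ ≤ ε₁ := fun z hz => by
      have hzR : ‖z‖ = R := by simpa using hz
      have hzb : 1 ≤ ‖z - b‖ := by
        have h1 := norm_sub_norm_le z (z - b)
        have h2 := norm_sub_norm_le b a
        have h3 := le_max_right R₁ (‖a‖ + 2)
        rw [sub_sub_cancel] at h1
        linarith
      have hz' := sphere_subset_closedBall hz
      have key : (z - b) * (g₁ z - f₁ z) = (g z - f z) + (b - a) * f₁ z := by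
        rw [congrFun hgg₁ z, congrFun hff₁ z]; ring
      calc ‖g₁ z - f₁ z‖ ≤ ‖z - b‖ * ‖g₁ z - f₁ z‖ := le_mul_of_one_le_left (norm_nonneg _) hzb
        _ = ‖(g z - f z) + (b - a) * f₁ z‖ := by rw [← norm_mul, key]
        _ ≤ ‖g z - f z‖ + ‖b - a‖ * ‖f₁ z‖ := (norm_add_le _ _).trans_eq (by rw [norm_mul])
        _ ≤ ε₁ / 2 + δ * M := by
          gcongr
          · exact (hgf z hz').trans (min_le_right _ _)
          · exact hM z hz'
        _ ≤ ε₁ := by linarith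
    have hball : ∀ z ∈ closedBall (0 : ℂ) R, ‖g₁ z - f₁ z‖ ≤ ε₁ := fun z hz => by
      rw [← closure_ball _ hR0.ne'] at hz
      refine Complex.norm_le_of_forall_mem_frontier_norm_le (f := fun z => g₁ z - f₁ z)
        isBounded_ball (hg₁.sub hf₁).diffContOnCl (fun w hw => ?_) hz
      exact hsphere w (by rwa [frontier_ball _ hR0.ne'] at hw)
    have := h₁ g₁ hg₁ fun z hz =>
      hball z (closedBall_subset_closedBall (le_max_left _ _) hz)
    rw [hgg₁, zeroCount_sub_mul hg₁, Nat.cast_add, Nat.cast_one, add_comm]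
    gcongr

end Stellar

/-! ### The trace norm of a difference of pure states -/

namespace Stellar

section TraceNorm

open InnerProductSpace

variable {H : Type} [NormedAddCommGroup H] [InnerProductSpace ℂ H]

theorem hasSum_inner_rankOne (b : HilbertBasis ℕ ℂ H) (u v : H) :
    HasSum (fun n => inner ℂ (b n) (rankOne ℂ u v (b n))) (inner ℂ v u) := by
  simpa [inner_smul_right] using b.hasSum_inner_mul_inner v u

theorem inner_mul_inner_swap (x y : H) :
    inner ℂ x y * inner ℂ y x = ((‖inner ℂ x y‖ ^ 2 : ℝ) : ℂ) := by
  rw [← inner_conj_symm y x, Complex.mul_conj, Complex.normSq_eq_norm_sq]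

theorem sq_sqrt_one_sub_norm_inner {x y : H} (hx : ‖x‖ = 1) (hy : ‖y‖ = 1) :
    √(1 - ‖inner ℂ x y‖ ^ 2) ^ 2 = 1 - ‖inner ℂ x y‖ ^ 2 := by
  have h := norm_inner_le_norm (𝕜 := ℂ) x y
  rw [hx, hy, mul_one] at h
  exact Real.sq_sqrt (by nlinarith [norm_nonneg (inner ℂ x y)])

theorem rankOne_sub_mul_self {x y : H} (hx : ‖x‖ = 1) (hy : ‖y‖ = 1) :
    (rankOne ℂ x x - rankOne ℂ y y) * (rankOne ℂ x x - rankOne ℂ y y) =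
      rankOne ℂ x x + rankOne ℂ y y - (inner ℂ x y) • rankOne ℂ x y
        - (inner ℂ y x) • rankOne ℂ y x := by
  have hxx : inner ℂ x x = 1 := by simp [inner_self_eq_norm_sq_to_K, hx]
  have hyy : inner ℂ y y = 1 := by simp [inner_self_eq_norm_sq_to_K, hy]
  ext z
  simp only [mul_apply_eq_comp, sub_apply,
    add_apply, smul_apply, rankOne_apply, inner_sub_right,
    inner_smul_right, hxx, hyy]
  module

/-- The square of `|x⟩⟨x| - |y⟩⟨y|` acts on the range of this operator as the scalar
`1 - |⟨x, y⟩|²`. -/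
theorem rankOne_sub_mul_self_mul {x y : H} (hx : ‖x‖ = 1) (hy : ‖y‖ = 1) :
    (rankOne ℂ x x - rankOne ℂ y y) * (rankOne ℂ x x - rankOne ℂ y y) *
        (rankOne ℂ x x - rankOne ℂ y y) =
      ((1 - ‖inner ℂ x y‖ ^ 2 : ℝ) : ℂ) • (rankOne ℂ x x - rankOne ℂ y y) := by
  have hxx : inner ℂ x x = 1 := by simp [inner_self_eq_norm_sq_to_K, hx]
  have hyy : inner ℂ y y = 1 := by simp [inner_self_eq_norm_sq_to_K, hy]
  rw [rankOne_sub_mul_self hx hy, Complex.ofReal_sub, ← inner_mul_inner_swap]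
  ext z
  simp only [mul_apply_eq_comp, sub_apply,
    add_apply, smul_apply, rankOne_apply, inner_sub_right,
    inner_smul_right, hxx, hyy, Complex.ofReal_one]
  module

variable [CompleteSpace H]

/-- With `s = √(1 - |⟨x, y⟩|²)`, the operator `T = |x⟩⟨x| - |y⟩⟨y|` satisfies `T³ = s² T`, whence
`|T| = s⁻¹ T²`. (If `s = 0`, both sides vanish.) -/
theorem abs_rankOne_sub {x y : H} (hx : ‖x‖ = 1) (hy : ‖y‖ = 1) :
    CFC.abs (rankOne ℂ x x - rankOne ℂ y y) =
      (√(1 - ‖inner ℂ x y‖ ^ 2))⁻¹ •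
        ((rankOne ℂ x x - rankOne ℂ y y) * (rankOne ℂ x x - rankOne ℂ y y)) := by
  set T := rankOne ℂ x x - rankOne ℂ y y with hT
  set s := √(1 - ‖inner ℂ x y‖ ^ 2) with hs
  have hs2 : s ^ 2 = 1 - ‖inner ℂ x y‖ ^ 2 := sq_sqrt_one_sub_norm_inner hx hy
  have hstar : star T = T := by
    rw [hT, star_sub, ContinuousLinearMap.star_eq_adjoint, ContinuousLinearMap.star_eq_adjoint,
      adjoint_rankOne, adjoint_rankOne]
  have h3 : T * T * T = (s ^ 2) • T := by
    rw [hs2, rankOne_sub_mul_self_mul hx hy]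
    rfl
  have h4 : (T * T) * (T * T) = (s ^ 2) • (T * T) := by
    rw [← mul_assoc, h3, smul_mul_assoc]
  have hpos : 0 ≤ T * T := by
    have := star_mul_self_nonneg T
    rwa [hstar] at this
  rw [CFC.abs, hstar]
  refine CFC.sqrt_unique ?_ (smul_nonneg (by positivity) hpos)
  rw [smul_mul_smul_comm, h4, smul_smul]
  by_cases h0 : s = 0
  · have : star (T * T) * (T * T) = 0 := by rw [star_mul, hstar, h4, h0]; simp
    rw [CStarRing.star_mul_self_eq_zero_iff] at this
    simp [this]
  · rw [show s⁻¹ * s⁻¹ * s ^ 2 = 1 by field_simp, one_smul]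

/-- The trace norm distance of two pure states in terms of their overlap. -/
theorem traceNormOf_rankOne_sub (b : HilbertBasis ℕ ℂ H) {x y : H} (hx : ‖x‖ = 1)
    (hy : ‖y‖ = 1) :
    traceNormOf b (rankOne ℂ x x - rankOne ℂ y y) =
      ENNReal.ofReal (2 * √(1 - ‖inner ℂ x y‖ ^ 2)) := by
  have hxx : inner ℂ x x = 1 := by simp [inner_self_eq_norm_sq_to_K, hx]
  have hyy : inner ℂ y y = 1 := by simp [inner_self_eq_norm_sq_to_K, hy]
  set s := √(1 - ‖inner ℂ x y‖ ^ 2) with hs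
  have hs2 : s ^ 2 = 1 - ‖inner ℂ x y‖ ^ 2 := sq_sqrt_one_sub_norm_inner hx hy
  have hsum : HasSum (fun n => RCLike.re (inner ℂ (b n)
      (CFC.abs (rankOne ℂ x x - rankOne ℂ y y) (b n)))) (2 * s) := by
    have h := (((hasSum_inner_rankOne b x x).add (hasSum_inner_rankOne b y y)).sub
      ((hasSum_inner_rankOne b x y).mul_left (inner ℂ x y))).sub
      ((hasSum_inner_rankOne b y x).mul_left (inner ℂ y x))
    rw [mul_comm (inner ℂ y x), inner_mul_inner_swap, hxx, hyy] at h
    have h' := (Complex.hasSum_re h).mul_left s⁻¹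
    have hval : s⁻¹ * (1 + 1 - ((‖inner ℂ x y‖ ^ 2 : ℝ) : ℂ) -
        ((‖inner ℂ x y‖ ^ 2 : ℝ) : ℂ)).re = 2 * s := by
      have : (1 + 1 - ((‖inner ℂ x y‖ ^ 2 : ℝ) : ℂ) - ((‖inner ℂ x y‖ ^ 2 : ℝ) : ℂ)).re
          = 2 * s ^ 2 := by
        simp only [Complex.sub_re, Complex.add_re, Complex.one_re, Complex.ofReal_re]
        linarith
      rw [this]
      by_cases h0 : s = 0
      · simp [h0]
      · field_simp
    rw [hval] at h'
    refine h'.congr_fun fun n => ?_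
    rw [abs_rankOne_sub hx hy, rankOne_sub_mul_self hx hy, smul_apply,
      inner_smul_right_eq_smul]
    simp only [sub_apply, add_apply,
      smul_apply, inner_sub_right, inner_add_right, inner_smul_right]
    simp [hs, inner_smul_right]
  rw [traceNormOf, ← hsum.tsum_eq, ENNReal.ofReal_tsum_of_nonneg _ hsum.summable]
  intro n
  have hp := (ContinuousLinearMap.nonneg_iff_isPositive _).1
    (CFC.abs_nonneg (rankOne ℂ x x - rankOne ℂ y y))
  exact hp.re_inner_nonneg_right (b n)

end TraceNorm

theorem traceNorm_density_sub (φ ψ : PureState) :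
    traceNorm (φ.density - ψ.density) =
      ENNReal.ofReal (2 * √(1 - ‖inner ℂ φ.vec ψ.vec‖ ^ 2)) :=
  traceNormOf_rankOne_sub fockBasis φ.norm_vec ψ.norm_vec

theorem norm_sub_inner_smul {H : Type} [NormedAddCommGroup H] [InnerProductSpace ℂ H] {x y : H}
    (hx : ‖x‖ = 1) (hy : ‖y‖ = 1) :
    ‖y - inner ℂ x y • x‖ = √(1 - ‖inner ℂ x y‖ ^ 2) := by
  rw [← Real.sqrt_sq (norm_nonneg _), @norm_sub_sq ℂ]
  congr 1
  rw [inner_smul_right, inner_mul_inner_swap, norm_smul, hx, hy]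
  rw [show RCLike.re (((‖inner ℂ x y‖ ^ 2 : ℝ) : ℂ)) = ‖inner ℂ x y‖ ^ 2 from Complex.ofReal_re _]
  ring

theorem sqrt_one_sub_norm_inner_le {H : Type} [NormedAddCommGroup H] [InnerProductSpace ℂ H]
    {x y : H} (hx : ‖x‖ = 1) (hy : ‖y‖ = 1) :
    √(1 - ‖inner ℂ x y‖ ^ 2) ≤ ‖x - y‖ := by
  refine Real.sqrt_le_iff.2 ⟨norm_nonneg _, ?_⟩
  rw [@norm_sub_sq ℂ, hx, hy]
  have h := Complex.re_le_norm (inner ℂ x y)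
  change _ ≤ _ - 2 * (inner ℂ x y).re + _
  nlinarith [sq_nonneg (‖inner ℂ x y‖ - 1)]

end Stellar

/-! ### The stellar function and the approximation by functions with one more zero -/

namespace Stellar

open Filter Topology Metric
open scoped ComplexConjugate

theorem summable_norm_sq (v : ModeSpace) : Summable fun n => ‖v n‖ ^ 2 := by
  simpa using (lp.memℓp v).summable (p := 2) (by norm_num)

theorem norm_sq_eq_tsum (v : ModeSpace) : ‖v‖ ^ 2 = ∑' n, ‖v n‖ ^ 2 := by
  simpa using lp.norm_rpow_eq_tsum (p := 2) (by norm_num) v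

theorem memℓp_two_of_summable {f : ℕ → ℂ} (hf : Summable fun n => ‖f n‖ ^ 2) :
    Memℓp f 2 :=
  memℓp_gen (by simpa using hf)

theorem norm_coherent_coeff_sq (z : ℂ) (n : ℕ) :
    ‖conj z ^ n / ((√(n.factorial : ℝ) : ℝ) : ℂ)‖ ^ 2 = (‖z‖ ^ 2) ^ n / n.factorial := by
  rw [norm_div, norm_pow, RCLike.norm_conj, Complex.norm_real, Real.norm_of_nonneg
    (Real.sqrt_nonneg _), div_pow, Real.sq_sqrt (by positivity), ← pow_mul, ← pow_mul, mul_comm]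

/-- The unnormalised coherent state at `z`, with coordinates `conj z ^ n / √(n!)`. It is the
reproducing kernel of the Segal–Bargmann space: the inner product with it is the value at `z` of the
stellar function. -/
noncomputable def coherent (z : ℂ) : ModeSpace :=
  ⟨fun n => conj z ^ n / ((√(n.factorial : ℝ) : ℝ) : ℂ), memℓp_two_of_summable <| by
    simpa only [norm_coherent_coeff_sq] using Real.summable_pow_div_factorial (‖z‖ ^ 2)⟩

theorem norm_coherent_sq (z : ℂ) : ‖coherent z‖ ^ 2 = Real.exp (‖z‖ ^ 2) := by
  rw [norm_sq_eq_tsum, Real.exp_eq_exp_ℝ, NormedSpace.exp_eq_tsum_div]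
  exact tsum_congr fun n => norm_coherent_coeff_sq z n

theorem inner_coherent_coeff (v : ModeSpace) (z : ℂ) (n : ℕ) :
    inner ℂ (coherent z n) (v n) = v n * z ^ n / ((√(n.factorial : ℝ) : ℝ) : ℂ) := by
  simp [coherent, mul_div_assoc]

/-- The stellar function `∑ₙ vₙ αⁿ / √(n!)` of an arbitrary, not necessarily normalised, vector. -/
noncomputable def bargmann (v : ModeSpace) (α : ℂ) : ℂ :=
  ∑' n : ℕ, v n * α ^ n / ((√(n.factorial : ℝ) : ℝ) : ℂ)

theorem hasSum_bargmann (v : ModeSpace) (z : ℂ) :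
    HasSum (fun n : ℕ => v n * z ^ n / ((√(n.factorial : ℝ) : ℝ) : ℂ)) (bargmann v z) := by
  have h := (lp.summable_inner (coherent z) v (𝕜 := ℂ)).hasSum
  simp only [inner_coherent_coeff] at h
  exact h

theorem bargmann_eq_inner (v : ModeSpace) (z : ℂ) : bargmann v z = inner ℂ (coherent z) v := by
  rw [lp.inner_eq_tsum]
  exact tsum_congr fun n => (inner_coherent_coeff v z n).symm

theorem norm_bargmann_sub_le (v w : ModeSpace) {R : ℝ} {z : ℂ} (hz : ‖z‖ ≤ R) :
    ‖bargmann v z - bargmann w z‖ ≤ Real.exp (R ^ 2) * ‖v - w‖ := by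
  rw [bargmann_eq_inner, bargmann_eq_inner, ← inner_sub_right]
  refine (norm_inner_le_norm _ _).trans (mul_le_mul_of_nonneg_right ?_ (norm_nonneg _))
  have h1 : 1 ≤ Real.exp (R ^ 2) := Real.one_le_exp (sq_nonneg R)
  have h2 : ‖coherent z‖ ^ 2 ≤ Real.exp (R ^ 2) := by
    rw [norm_coherent_sq]
    gcongr
  nlinarith [norm_nonneg (coherent z)]

theorem bargmann_smul (c : ℂ) (v : ModeSpace) (z : ℂ) :
    bargmann (c • v) z = c * bargmann v z := by
  simp only [bargmann_eq_inner, inner_smul_right]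

theorem hasFPowerSeriesOnBall_bargmann (v : ModeSpace) :
    HasFPowerSeriesOnBall (bargmann v) (FormalMultilinearSeries.ofScalars ℂ
      fun n => v n / ((√(n.factorial : ℝ) : ℝ) : ℂ)) 0 ⊤ := by
  set p := FormalMultilinearSeries.ofScalars ℂ fun n => v n / ((√(n.factorial : ℝ) : ℝ) : ℂ)
    with hp
  have hr : p.radius = ⊤ := by
    refine ENNReal.eq_top_of_forall_nnreal_le fun r => p.le_radius_of_summable_norm ?_
    have h := (hasSum_bargmann v (r : ℝ)).summable.norm
    refine h.congr fun n => ?_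
    rw [hp, FormalMultilinearSeries.ofScalars_norm]
    simp [div_mul_eq_mul_div]
  have h := p.hasFPowerSeriesOnBall (by rw [hr]; exact ENNReal.zero_lt_top)
  rw [hr] at h
  convert h using 1
  ext z
  rw [hp]
  change _ = FormalMultilinearSeries.ofScalarsSum _ z
  rw [FormalMultilinearSeries.ofScalars_sum_eq]
  exact tsum_congr fun n => by simp [div_mul_eq_mul_div]

theorem differentiable_bargmann (v : ModeSpace) : Differentiable ℂ (bargmann v) := by
  intro z
  exact ((hasFPowerSeriesOnBall_bargmann v).analyticAt_of_mem (by simp)).differentiableAt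

theorem exists_bargmann_ne_zero {v : ModeSpace} (hv : v ≠ 0) : ∃ z, bargmann v z ≠ 0 := by
  by_contra! h
  have h0 : bargmann v = 0 := funext h
  have hs := (hasFPowerSeriesOnBall_bargmann v).hasFPowerSeriesAt
  rw [h0] at hs
  have hc := (FormalMultilinearSeries.ofScalars_series_eq_zero ℂ).1 hs.eq_zero
  refine hv (lp.ext (funext fun n => ?_))
  have := congrFun hc n
  have hf : ((√(n.factorial : ℝ) : ℝ) : ℂ) ≠ 0 := by
    have : 0 < √(n.factorial : ℝ) := by positivity
    exact_mod_cast this.ne'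
  simpa [hf] using this

/-- The Fock coordinates of `α ↦ (1 - (1 - r) α) F(r α)`, where `F` is the stellar function of a
vector with coordinates `v`: for `r < 1` the additional zero is at `1 / (1 - r)`. At `n = 0` the
factor `√n` kills the term with the truncated index `n - 1`. -/
noncomputable def addZeroCoeff (v : ℕ → ℂ) (r : ℝ) (n : ℕ) : ℂ :=
  (r : ℂ) ^ n * v n - (1 - r) * r ^ (n - 1) * (√(n : ℝ) : ℝ) * v (n - 1)

/-- The bound is uniform in `r` because `(1 - r) n r ^ (n - 1) ≤ (1 - r) (1 + r + ⋯ + r ^ (n - 1)) ≤ 1`. -/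
theorem norm_addZeroCoeff_sub_le (v : ℕ → ℂ) {r : ℝ} (hr0 : 0 ≤ r) (hr1 : r ≤ 1) (n : ℕ) :
    ‖addZeroCoeff v r n - v n‖ ≤ ‖v n‖ + ‖v (n - 1)‖ := by
  have h1 : ‖((r : ℂ) ^ n - 1) * v n‖ ≤ ‖v n‖ := by
    have : ((r : ℂ) ^ n - 1) = ((r ^ n - 1 : ℝ) : ℂ) := by push_cast; rfl
    rw [norm_mul, this, Complex.norm_real, Real.norm_eq_abs]
    refine mul_le_of_le_one_left (norm_nonneg _) (abs_le.2 ⟨?_, ?_⟩)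
    · linarith [pow_nonneg hr0 n]
    · linarith [pow_le_one₀ hr0 hr1 (n := n)]
  have hb : (1 - r) * r ^ (n - 1) * √(n : ℝ) ≤ 1 := by
    have hsqrt : √(n : ℝ) ≤ n := by
      rcases Nat.eq_zero_or_pos n with rfl | hn
      · simp
      · have : (1 : ℝ) ≤ n := by exact_mod_cast hn
        exact Real.sqrt_le_self_iff.2 (Or.inr this)
    have hgeom : n * r ^ (n - 1) ≤ ∑ i ∈ Finset.range n, r ^ i := by
      rw [← nsmul_eq_mul]
      simpa using Finset.card_nsmul_le_sum (Finset.range n) (fun i => r ^ i) (r ^ (n - 1))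
        fun i hi => pow_le_pow_of_le_one hr0 hr1 (Nat.le_sub_one_of_lt (Finset.mem_range.1 hi))
    calc (1 - r) * r ^ (n - 1) * √(n : ℝ) ≤ (1 - r) * r ^ (n - 1) * n := by
          have : 0 ≤ 1 - r := by linarith
          gcongr
      _ = (1 - r) * (n * r ^ (n - 1)) := by ring
      _ ≤ (1 - r) * ∑ i ∈ Finset.range n, r ^ i := by
          have : 0 ≤ 1 - r := by linarith
          gcongr
      _ = 1 - r ^ n := mul_neg_geom_sum r n
      _ ≤ 1 := by linarith [pow_nonneg hr0 n]
  have h2 : ‖(1 - (r : ℂ)) * r ^ (n - 1) * (√(n : ℝ) : ℝ) * v (n - 1)‖ ≤ ‖v (n - 1)‖ := by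
    have : (1 - (r : ℂ)) * r ^ (n - 1) * (√(n : ℝ) : ℝ) =
        (((1 - r) * r ^ (n - 1) * √(n : ℝ) : ℝ) : ℂ) := by push_cast; rfl
    have h0 : 0 ≤ (1 - r) * r ^ (n - 1) * √(n : ℝ) := by
      have : 0 ≤ 1 - r := by linarith
      positivity
    rw [norm_mul, this, Complex.norm_real, Real.norm_of_nonneg h0]
    exact mul_le_of_le_one_left (norm_nonneg _) hb
  have heq : addZeroCoeff v r n - v n = ((r : ℂ) ^ n - 1) * v n -
      (1 - (r : ℂ)) * r ^ (n - 1) * (√(n : ℝ) : ℝ) * v (n - 1) := by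
    unfold addZeroCoeff; ring
  rw [heq]
  exact (norm_sub_le _ _).trans (add_le_add h1 h2)

theorem norm_addZeroCoeff_sub_sq_le (v : ℕ → ℂ) {r : ℝ} (hr0 : 0 ≤ r) (hr1 : r ≤ 1) (n : ℕ) :
    ‖addZeroCoeff v r n - v n‖ ^ 2 ≤ 2 * ‖v n‖ ^ 2 + 2 * ‖v (n - 1)‖ ^ 2 := by
  have := norm_addZeroCoeff_sub_le v hr0 hr1 n
  nlinarith [norm_nonneg (addZeroCoeff v r n - v n), sq_nonneg (‖v n‖ - ‖v (n - 1)‖)]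

theorem summable_addZero_bound (v : ModeSpace) :
    Summable fun n : ℕ => 2 * ‖v n‖ ^ 2 + 2 * ‖v (n - 1)‖ ^ 2 := by
  refine ((summable_norm_sq v).mul_left 2).add (Summable.mul_left 2 ?_)
  rw [← summable_nat_add_iff 1]
  simpa using summable_norm_sq v

theorem tendsto_tsum_addZeroCoeff (v : ModeSpace) :
    Tendsto (fun r : ℝ => ∑' n, ‖addZeroCoeff v r n - v n‖ ^ 2) (𝓝[<] 1) (𝓝 0) := by
  have h := tendsto_tsum_of_dominated_convergence (𝓕 := 𝓝[<] (1 : ℝ))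
    (f := fun r n => ‖addZeroCoeff v r n - v n‖ ^ 2) (g := fun _ => 0)
    (summable_addZero_bound v) (fun n => ?_) ?_
  · simpa using h
  · have hc : Continuous fun r : ℝ => ‖addZeroCoeff v r n - v n‖ ^ 2 := by
      unfold addZeroCoeff
      fun_prop
    simpa [addZeroCoeff] using (hc.tendsto 1).mono_left nhdsWithin_le_nhds
  · filter_upwards [Ioo_mem_nhdsLT (show (0 : ℝ) < 1 by norm_num)] with r hr n
    rw [Real.norm_of_nonneg (by positivity)]
    exact norm_addZeroCoeff_sub_sq_le v hr.1.le hr.2.le n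

theorem bargmann_addZero {v w : ModeSpace} {r : ℝ} (hw : ∀ n, w n = addZeroCoeff v r n) (z : ℂ) :
    bargmann w z = (1 - (1 - r) * z) * bargmann v (r * z) := by
  have h1 := hasSum_bargmann v (r * z)
  have h2 : HasSum (fun n : ℕ => (1 - (r : ℂ)) * r ^ (n - 1) * (√(n : ℝ) : ℝ) * v (n - 1) * z ^ n /
      ((√(n.factorial : ℝ) : ℝ) : ℂ)) ((1 - r) * z * bargmann v (r * z)) := by
    rw [← hasSum_nat_add_iff' 1]
    simp only [Finset.range_one, Finset.sum_singleton, Nat.cast_zero, Real.sqrt_zero,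
      Complex.ofReal_zero, mul_zero, zero_mul, zero_div, sub_zero]
    refine (h1.mul_left ((1 - (r : ℂ)) * z)).congr_fun fun n => ?_
    have hs : √((n + 1).factorial : ℝ) = √((n + 1 : ℕ) : ℝ) * √(n.factorial : ℝ) := by
      rw [← Real.sqrt_mul (by positivity), Nat.factorial_succ, Nat.cast_mul]
    have ha : ((√((n + 1 : ℕ) : ℝ) : ℝ) : ℂ) ≠ 0 := by
      have : 0 < √((n + 1 : ℕ) : ℝ) := by positivity
      exact_mod_cast this.ne'
    have hb : ((√(n.factorial : ℝ) : ℝ) : ℂ) ≠ 0 := by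
      have : 0 < √(n.factorial : ℝ) := by positivity
      exact_mod_cast this.ne'
    rw [hs, Complex.ofReal_mul, Nat.add_sub_cancel]
    field_simp
    ring
  have h3 := h1.sub h2
  have h4 := hasSum_bargmann w z
  have : bargmann w z = bargmann v (r * z) - (1 - r) * z * bargmann v (r * z) :=
    (h4.congr_fun fun n => by rw [hw]; unfold addZeroCoeff; ring).unique h3
  rw [this]
  ring

/-- Every vector can be approximated by vectors whose stellar function has exactly one more zero.
The dilation by `r < 1` makes the coordinates decay geometrically, so that multiplying the stellar
function by a linear factor does not lead out of the Hilbert space. -/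
theorem exists_near_zeroCount_eq (v : ModeSpace) {ε : ℝ} (hε : 0 < ε) :
    ∃ w : ModeSpace, ‖w - v‖ < ε ∧ zeroCount (bargmann w) = 1 + zeroCount (bargmann v) := by
  obtain ⟨r, hlt, hr⟩ := (((tendsto_tsum_addZeroCoeff v).eventually_lt_const
    (show 0 < ε ^ 2 by positivity)).and
    (Ioo_mem_nhdsLT (show (0 : ℝ) < 1 by norm_num))).exists
  let u : ModeSpace := ⟨fun n => addZeroCoeff v r n - v n, memℓp_two_of_summable <|
    (summable_addZero_bound v).of_nonneg_of_le (fun _ => by positivity)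
      fun n => norm_addZeroCoeff_sub_sq_le v hr.1.le hr.2.le n⟩
  refine ⟨v + u, ?_, ?_⟩
  · rw [add_sub_cancel_left, ← sq_lt_sq₀ (norm_nonneg _) hε.le, norm_sq_eq_tsum]
    exact hlt
  · have hw : ∀ n, (v + u) n = addZeroCoeff v r n := fun n => add_sub_cancel (v n) _
    have hr1 : (1 : ℂ) - r ≠ 0 := by
      rw [sub_ne_zero]
      exact_mod_cast hr.2.ne'
    have hr0 : (r : ℂ) ≠ 0 := by exact_mod_cast hr.1.ne'
    have hd : Differentiable ℂ fun z => bargmann v (r * z) :=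
      (differentiable_bargmann v).comp (differentiable_id.const_mul _)
    have hd' : Differentiable ℂ fun z => (z - (1 - r : ℂ)⁻¹) * bargmann v (r * z) :=
      (differentiable_id.sub_const _).mul hd
    have hfun : bargmann (v + u) = fun z =>
        (-(1 - r : ℂ)) * ((z - (1 - r : ℂ)⁻¹) * bargmann v (r * z)) := by
      ext z
      rw [bargmann_addZero hw]
      field_simp
      ring
    rw [hfun, zeroCount_const_mul hd' (neg_ne_zero.2 hr1),
      zeroCount_sub_mul hd, zeroCount_comp_mul _ hr0]

end Stellar

/-! ### The topology of stellar rank -/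

namespace Stellar

open Filter Topology Metric

theorem PureState.vec_ne_zero (ψ : PureState) : ψ.vec ≠ 0 := fun h => by
  simpa [h] using ψ.norm_vec

theorem stellarRank_eq_zeroCount (ψ : PureState) : stellarRank ψ = zeroCount (bargmann ψ.vec) :=
  rfl

/-- Lower semicontinuity of the stellar rank. A state `φ` at small trace distance from `ψ` need not
be close to `ψ` as a vector, but `⟨φ, ψ⟩ φ` is, and its stellar function has the zeros of that
of `φ`. -/
theorem exists_forall_le_stellarRank {ψ : PureState} {n : ℕ} (h : (n : ℕ∞) ≤ stellarRank ψ) :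
    ∃ ε : ℝ≥0∞, 0 < ε ∧ ∀ φ : PureState, traceNorm (φ.density - ψ.density) < ε →
      (n : ℕ∞) ≤ stellarRank φ := by
  obtain ⟨R, -, ε, hε, hnear⟩ := le_zeroCount_of_near n (differentiable_bargmann ψ.vec)
    (exists_bargmann_ne_zero ψ.vec_ne_zero) h
  set η := min 1 (ε / Real.exp (R ^ 2)) with hη
  have hη0 : 0 < η := by positivity
  refine ⟨ENNReal.ofReal (2 * η), by simpa using hη0, fun φ hφ => ?_⟩
  rw [traceNorm_density_sub, ENNReal.ofReal_lt_ofReal_iff (by positivity),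
    mul_lt_mul_iff_right₀ (by norm_num)] at hφ
  have hc : inner ℂ φ.vec ψ.vec ≠ 0 := fun hc => by
    rw [hc] at hφ
    have := hφ.trans_le (min_le_left _ _)
    simp at this
  rw [← norm_sub_inner_smul φ.norm_vec ψ.norm_vec, norm_sub_rev] at hφ
  rw [stellarRank_eq_zeroCount, ← zeroCount_const_mul (differentiable_bargmann φ.vec) hc]
  refine hnear _ ((differentiable_bargmann φ.vec).const_mul _) fun z hz => ?_
  rw [← bargmann_smul]
  refine (norm_bargmann_sub_le _ _ (mem_closedBall_zero_iff.1 hz)).trans ?_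
  rw [mul_comm, ← le_div_iff₀ (Real.exp_pos _)]
  exact hφ.le.trans (min_le_right _ _)

theorem isOpen_setOf_le_stellarRank (n : ℕ) : IsOpen {ψ : PureState | (n : ℕ∞) ≤ stellarRank ψ} :=
  fun _ hψ => exists_forall_le_stellarRank hψ

theorem isClosed_setOf_stellarRank_le (N : ℕ) :
    IsClosed {ψ : PureState | stellarRank ψ ≤ (N : ℕ∞)} := by
  convert (isOpen_setOf_le_stellarRank (N + 1)).isClosed_compl using 1
  ext ψ
  simp [Order.add_one_le_iff_of_not_isMax]

theorem exists_near_stellarRank_eq (ψ : PureState) {ε : ℝ} (hε : 0 < ε) :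
    ∃ φ : PureState, ‖φ.vec - ψ.vec‖ < ε ∧ stellarRank φ = 1 + stellarRank ψ := by
  obtain ⟨w, hw, hz⟩ := exists_near_zeroCount_eq ψ.vec (ε := min 1 (ε / 2)) (by positivity)
  have hw1 := hw.trans_le (min_le_left _ _)
  have hwε := hw.trans_le (min_le_right _ _)
  have habs : |‖w‖ - 1| ≤ ‖w - ψ.vec‖ := by
    simpa [ψ.norm_vec] using abs_norm_sub_norm_le w ψ.vec
  have hw0 : 0 < ‖w‖ := by linarith [neg_abs_le (‖w‖ - 1)]
  have hc : ((‖w‖⁻¹ : ℝ) : ℂ) ≠ 0 := by exact_mod_cast (inv_pos.2 hw0).ne'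
  let φ : PureState := ⟨((‖w‖⁻¹ : ℝ) : ℂ) • w, by
    rw [norm_smul, Complex.norm_real, norm_inv, norm_norm, inv_mul_cancel₀ hw0.ne']⟩
  refine ⟨φ, ?_, ?_⟩
  · have h1 : φ.vec - w = ((‖w‖⁻¹ - 1 : ℝ) : ℂ) • w := by
      simp [φ, sub_smul]
    have h2 : ‖φ.vec - w‖ = |‖w‖ - 1| := by
      rw [h1, norm_smul, Complex.norm_real, Real.norm_eq_abs, ← abs_of_pos hw0, ← abs_mul,
        abs_of_pos hw0, sub_mul, inv_mul_cancel₀ hw0.ne', one_mul, abs_sub_comm]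
    have h3 := norm_sub_le_norm_sub_add_norm_sub φ.vec w ψ.vec
    linarith
  · rw [stellarRank_eq_zeroCount, stellarRank_eq_zeroCount, ← hz,
      ← zeroCount_const_mul (differentiable_bargmann w) hc]
    exact congrArg zeroCount (funext fun z => bargmann_smul _ w z)

theorem rankSet_subset_closure_rankSet_succ (N : ℕ) :
    rankSet (N : ℕ∞) ⊆ closure (rankSet ((N + 1 : ℕ) : ℕ∞)) := by
  intro ψ hψ
  refine mem_closure_iff.2 fun U hU hψU => ?_
  obtain ⟨ε, hε, hball⟩ := hU ψ hψU
  obtain ⟨δ, hδ, hδε⟩ := ENNReal.lt_iff_exists_nnreal_btwn.1 hε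
  have hδ0 : (0 : ℝ) < δ := by exact_mod_cast hδ
  obtain ⟨φ, hφ, hrank⟩ := exists_near_stellarRank_eq ψ (half_pos hδ0)
  refine ⟨φ, hball φ (lt_of_le_of_lt ?_ hδε), ?_⟩
  · rw [traceNorm_density_sub, ← ENNReal.ofReal_coe_nnreal]
    have := sqrt_one_sub_norm_inner_le φ.norm_vec ψ.norm_vec
    exact ENNReal.ofReal_le_ofReal (by linarith)
  · have hψ' : stellarRank ψ = N := hψ
    change stellarRank φ = _
    rw [hrank, hψ', Nat.cast_add, Nat.cast_one, add_comm]

theorem rankSet_subset_closure_rankSet {K N : ℕ} (h : K ≤ N) :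
    rankSet (K : ℕ∞) ⊆ closure (rankSet (N : ℕ∞)) := by
  induction N, h using Nat.le_induction with
  | base => exact subset_closure
  | succ N _ ih =>
    exact ih.trans (closure_minimal (rankSet_subset_closure_rankSet_succ N) isClosed_closure)

end Stellar

theorem theorem5 :
    (∀ N : ℕ, closure (Stellar.rankSet (N : ℕ∞)) =
      ⋃ (K : ℕ) (_ : K ≤ N), Stellar.rankSet (K : ℕ∞)) ∧
    (∀ N : ℕ, IsClosed {ψ : Stellar.PureState | Stellar.stellarRank ψ ≤ (N : ℕ∞)}) ∧
    (∀ ψ : Stellar.PureState, Stellar.stellarRank ψ < ⊤ → 0 < Stellar.stellarRobustness ψ) := by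
  refine ⟨fun N => ?_, Stellar.isClosed_setOf_stellarRank_le, fun ψ hψ => ?_⟩
  · refine Set.Subset.antisymm ?_ (Set.iUnion₂_subset fun K hK =>
      Stellar.rankSet_subset_closure_rankSet hK)
    intro ψ hψ
    have hle : Stellar.stellarRank ψ ≤ N :=
      closure_minimal (fun φ (hφ : _ = _) => hφ.le) (Stellar.isClosed_setOf_stellarRank_le N) hψ
    obtain ⟨K, hK, hKN⟩ := ENat.le_natCast_iff.1 hle
    exact Set.mem_iUnion₂.2 ⟨K, hKN, hK⟩
  · obtain ⟨n, hn⟩ := ENat.ne_top_iff_exists.1 hψ.ne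
    obtain ⟨ε, hε, hball⟩ := Stellar.exists_forall_le_stellarRank hn.le
    refine (ENNReal.half_pos hε.ne').trans_le (le_iInf₂ fun φ hφ => ?_)
    refine ENNReal.div_le_div_right (not_lt.1 fun h => ?_) 2
    exact absurd (hn ▸ hball φ h) hφ.not_ge
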